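/- Let $(K_0,\prec_{K_0})$ be an abstract elementary class (AEC) in a vocabulary $\tau_{K_0}$: a class of $\tau_{K_0}$-structures with a partial order $\prec_{K_0}$ refining the substructure relation, both closed under isomorphism, such that: (i) if $M_0\subseteq M_1$, $M_0\prec_{K_0}M_2$ and $M_1\prec_{K_0}M_2$, then $M_0\prec_{K_0}M_1$; (ii) the union of a nonempty well-ordered $\prec_{K_0}$-increasing chain belongs to $K_0$, every member of the chain is strong in the union, and if every member of the chain is strong in $N$, then so is the union; (iii) there is a cardinal $\mu$ such that every subset $X$ of every $M\in K_0$ is contained in some $M'\prec_{K_0}M$ with $|M'|\le|X|+\mu$. Let $\hat K_0$ be the class of structures $M$ with unary predicates $A,B,C$, a ternary relation $E$, and a $\tau_{K_0}$-structure on $C^M$, such that - $A^M,B^M,C^M$ are non-empty and partition the universe, and $E^M\subseteq A^M\times B^M\times C^M$ is the graph of a total function $F:A^M\times B^M\to C^M$ (a coloring of the edges of the complete bipartite graph on $A^M,B^M$); - there is no monochromatic $K_{2,2}$: for all distinct $a_1,a_2\in A^M$ and distinct $b_1,b_2\in B^M$ the four values $F(a_i,b_j)$, $i,j\in\{1,2\}$,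 are not all equal; - $C^M$, with its $\tau_{K_0}$-structure, belongs to $K_0$. For $M,N\in\hat K_0$ put $M\prec_{\hat K_0}N$ if $M$ is a substructure of $N$ and $C^M\prec_{K_0}C^N$. A model $M\in\hat K_0$ is maximal if there is no $N\in\hat K_0$ with $M\prec_{\hat K_0}N$ and $N\ne M$; it is of type $(\lambda,\mu)$ if $|A^M|=\lambda$ and $|B^M|=\mu$. **Theorem.** Let $\kappa$ be an infinite cardinal. If $K_0$ is an AEC that has a model of cardinality $\kappa$ but no model of cardinality greater than $\kappa$, then there is a family of $2^{\kappa^+}$ pairwise non-isomorphic maximal models of $\hat K_0$, each of type $(\kappa^+,\kappa^+)$. -/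

import Mathlib

open scoped FirstOrder

universe u v w

/-- An abstract elementary class in the vocabulary `L`: a class `Mem` of `L`-structures together
with a strong substructure relation; `Strong M S` says that `S` is a strong substructure of `M`. -/
structure AbstractElementaryClass (L : FirstOrder.Language.{v, w}) where
  /-- Membership in the class. -/
  Mem : (M : Type u) → [L.Structure M] → Prop
  /-- `Strong M S`: the substructure `S` of `M` is strong in `M`. -/
  Strong : (M : Type u) → [L.Structure M] → L.Substructure M → Prop
  /-- The class is closed under isomorphism. -/
  mem_iso : ∀ {M N : Type u} [L.Structure M] [L.Structure N], (M ≃[L] N) → Mem M → Mem N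
  /-- The strong substructure relation is invariant under isomorphism. -/
  strong_iso : ∀ {M N : Type u} [L.Structure M] [L.Structure N] (e : M ≃[L] N)
    (S : L.Substructure M), Strong M S → Strong N (S.map e.toHom)
  /-- The strong substructure relation is a relation between members of the class. -/
  mem_of_strong : ∀ {M : Type u} [L.Structure M] (S : L.Substructure M),
    Strong M S → Mem S ∧ Mem M
  /-- Reflexivity. -/
  strong_refl : ∀ {M : Type u} [L.Structure M], Mem M → Strong M ⊤
  /-- Transitivity. -/
  strong_trans : ∀ {M : Type u} [L.Structure M] (T : L.Substructure M) (S : L.Substructure T),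
    Strong T S → Strong M T → Strong M (S.map T.subtype.toHom)
  /-- Coherence: if `S ⊆ T` and both are strong in `M`, then `S` is strong in `T`. -/
  coherence : ∀ {M : Type u} [L.Structure M] (T : L.Substructure M) (S : L.Substructure T),
    Strong M (S.map T.subtype.toHom) → Strong M T → Strong T S
  /-- The union of a (well-ordered) increasing strong chain belongs to the class. -/
  chain_mem : ∀ {M : Type u} [L.Structure M] {ι : Type u} [LinearOrder ι] [WellFoundedLT ι]
    [Nonempty ι] (S : ι → L.Substructure M), Monotone S →
    (∀ i j, i ≤ j → Strong (S j) ((S i).comap (S j).subtype.toHom)) →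
    Mem (⨆ i, S i : L.Substructure M)
  /-- Each member of such a chain is strong in the union. -/
  chain_strong : ∀ {M : Type u} [L.Structure M] {ι : Type u} [LinearOrder ι] [WellFoundedLT ι]
    [Nonempty ι] (S : ι → L.Substructure M), Monotone S →
    (∀ i j, i ≤ j → Strong (S j) ((S i).comap (S j).subtype.toHom)) →
    ∀ j, Strong (⨆ i, S i : L.Substructure M)
      ((S j).comap (⨆ i, S i : L.Substructure M).subtype.toHom)
  /-- If each member of such a chain is strong in `M`, then so is the union. -/
  chain_smooth : ∀ {M : Type u} [L.Structure M] {ι : Type u} [LinearOrder ι] [WellFoundedLT ι]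
    [Nonempty ι] (S : ι → L.Substructure M), Monotone S →
    (∀ i j, i ≤ j → Strong (S j) ((S i).comap (S j).subtype.toHom)) →
    (∀ i, Strong M (S i)) → Strong M (⨆ i, S i)
  /-- There is a Löwenheim–Skolem number. -/
  lowenheimSkolem : ∃ μ : Cardinal.{u}, ∀ {M : Type u} [L.Structure M], Mem M → ∀ X : Set M,
    ∃ S : L.Substructure M, X ⊆ S ∧ Strong M S ∧ Cardinal.mk S ≤ Cardinal.mk X + μ

/-- A structure for the vocabulary consisting of unary predicates `A`, `B`, `C`, a ternary relation
`E`, and the symbols of `L`, where the symbols of `L` live on the color sort `C` only. -/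
structure HatStructure (L : FirstOrder.Language.{v, w}) where
  carrier : Type u
  A : Set carrier
  B : Set carrier
  C : Set carrier
  E : carrier → carrier → carrier → Prop
  colorStructure : L.Structure C

namespace HatStructure

variable {L : FirstOrder.Language.{v, w}}

instance (M : HatStructure.{u} L) : L.Structure M.C := M.colorStructure

/-- `A`, `B`, `C` are nonempty and partition the universe, and `E ⊆ A × B × C` is (the graph of)
a total function from `A × B` to `C`. -/
structure Sigma0 (M : HatStructure.{u} L) : Prop where
  nonempty_A : M.A.Nonempty
  nonempty_B : M.B.Nonempty
  nonempty_C : M.C.Nonempty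
  cover : M.A ∪ M.B ∪ M.C = Set.univ
  disjoint_AB : Disjoint M.A M.B
  disjoint_AC : Disjoint M.A M.C
  disjoint_BC : Disjoint M.B M.C
  sort_E : ∀ a b c, M.E a b c → a ∈ M.A ∧ b ∈ M.B ∧ c ∈ M.C
  function_E : ∀ a ∈ M.A, ∀ b ∈ M.B, ∃! c, M.E a b c

/-- `Sigma0`, and there is no monochromatic `K_{2,2}`. -/
structure Sigma1 (M : HatStructure.{u} L) : Prop extends Sigma0 M where
  no_mono : ∀ a₁ ∈ M.A, ∀ a₂ ∈ M.A, ∀ b₁ ∈ M.B, ∀ b₂ ∈ M.B, a₁ ≠ a₂ → b₁ ≠ b₂ →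
    ¬ ∃ c, M.E a₁ b₁ c ∧ M.E a₁ b₂ c ∧ M.E a₂ b₁ c ∧ M.E a₂ b₂ c

/-- An embedding of structures: an injection that preserves and reflects `A`, `B`, `C`, `E`
and restricts to an `L`-embedding of the color sorts. -/
structure Embedding (M N : HatStructure.{u} L) where
  toFun : M.carrier → N.carrier
  injective : Function.Injective toFun
  mem_A : ∀ x, toFun x ∈ N.A ↔ x ∈ M.A
  mem_B : ∀ x, toFun x ∈ N.B ↔ x ∈ M.B
  mem_C : ∀ x, toFun x ∈ N.C ↔ x ∈ M.C
  map_E : ∀ x y z, N.E (toFun x) (toFun y) (toFun z) ↔ M.E x y z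
  color : M.C ↪[L] N.C
  color_eq : ∀ c : M.C, (color c : N.carrier) = toFun c

/-- Isomorphism: there is a surjective embedding. -/
def Isomorphic (M N : HatStructure.{u} L) : Prop :=
  ∃ f : Embedding M N, Function.Surjective f.toFun

/-- `(κ, μ)`-models: the two sides of the bipartite graph have cardinalities `κ` and `μ`. -/
def HasType (M : HatStructure.{u} L) (κ μ : Cardinal.{u}) : Prop :=
  Cardinal.mk M.A = κ ∧ Cardinal.mk M.B = μ

end HatStructure

namespace AbstractElementaryClass

variable {L : FirstOrder.Language.{v, w}} (K : AbstractElementaryClass.{u} L)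

/-- The class associated with `K`: models of `Sigma1` whose color sort is the domain of a model
in `K`. -/
def HatMem (M : HatStructure.{u} L) : Prop :=
  M.Sigma1 ∧ K.Mem M.C

/-- The strong substructure relation of the associated class, for embeddings: the image of the
color sort of `M` is a strong substructure of the color sort of `N`. -/
def HatStrong {M N : HatStructure.{u} L} (f : M.Embedding N) : Prop :=
  K.HatMem M ∧ K.HatMem N ∧ K.Strong N.C f.color.toHom.range

/-- `M` is a maximal model of the associated class: it has no proper strong extension there. -/
def HatMaximal (M : HatStructure.{u} L) : Prop :=
  K.HatMem M ∧ ∀ (N : HatStructure.{u} L) (f : M.Embedding N),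
    K.HatStrong f → Function.Surjective f.toFun

end AbstractElementaryClass

/-! Since `K` has no model above `κ`, a Zorn argument gives a model `C` of cardinality `κ` without
proper strong extensions (`exists_maximal_model`). With `C` as color sort no extension can add a
color, so only new vertices have to be excluded.

A new vertex joins κ⁺ old vertices in only `κ` colors, so two of them, `y` and `z`, get the same
color `c`. If `y` and `z` already have a common neighbor in color `c`, a monochromatic K₂,₂ appears.
It therefore suffices to avoid monochromatic K₂,₂ while giving any two of κ⁺ vertices a common
neighbor of every color. `exists_recursive_coloring` does this along a well-order of type κ⁺: each
vertex colors its predecessors injectively, except that it may become the missing common neighbor of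
one pair.

The resulting symmetric coloring `G` is only needed off the diagonal. Two extra colors on the
diagonal code a subset of κ⁺, and two extra vertices on each side restore common neighbors in these
colors (`extend`). For large `δ`, `δ` is the only `x ≥ δ` whose `G`-edges to the vertices below `δ`
show all colors, so every isomorphism fixes a tail pointwise (`diagonal_eq_of_iso`). The subset is
recovered because each of its bits is repeated unboundedly often. -/

namespace AbstractElementaryClass

/-! ### Strong extensions and unions of chains inside a fixed set -/

open FirstOrder FirstOrder.Language

variable {L : FirstOrder.Language.{v, w}} (K : AbstractElementaryClass.{u} L)

/-- An embedding whose range is a strong substructure of its codomain. -/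
def StrongEmb {M N : Type u} [L.Structure M] [L.Structure N] (f : M ↪[L] N) : Prop :=
  K.Strong N f.toHom.range

variable {K}

theorem StrongEmb.of_surjective {M N : Type u} [L.Structure M] [L.Structure N] {f : M ↪[L] N}
    (hN : K.Mem N) (hf : Function.Surjective f) : K.StrongEmb f := by
  have h : f.toHom.range = ⊤ := Hom.range_eq_top.2 hf
  rw [StrongEmb, h]
  exact K.strong_refl hN

theorem StrongEmb.comp {M N P : Type u} [L.Structure M] [L.Structure N] [L.Structure P]
    {g : N ↪[L] P} {f : M ↪[L] N} (hg : K.StrongEmb g) (hf : K.StrongEmb f) :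
    K.StrongEmb (g.comp f) := by
  have h := K.strong_trans _ _ (K.strong_iso g.equivRange _ hf) hg
  have e : (g.comp f).toHom.range =
      (f.toHom.range.map g.equivRange.toHom).map g.toHom.range.subtype.toHom := by
    ext x
    simp only [Hom.mem_range, Substructure.mem_map]
    constructor
    · rintro ⟨y, rfl⟩
      exact ⟨g.equivRange (f y), ⟨f y, ⟨y, rfl⟩, rfl⟩, rfl⟩
    · rintro ⟨_, ⟨_, ⟨y, rfl⟩, rfl⟩, rfl⟩
      exact ⟨y, rfl⟩
  rw [StrongEmb, e]
  exact h

variable (K)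

/-- A member of `K` whose universe is a subset of `U`. -/
structure PartialModel (U : Type u) where
  X : Set U
  str : L.Structure X
  mem : K.Mem X

namespace PartialModel

variable {K} {U : Type u}

instance (p : PartialModel K U) : L.Structure p.X := p.str

/-- The inclusion of `p` into `q` is a strong embedding. -/
def Le (p q : PartialModel K U) : Prop :=
  ∃ f : p.X ↪[L] q.X, (∀ x, (f x : U) = x) ∧ K.StrongEmb f

theorem Le.subset {p q : PartialModel K U} (h : p.Le q) : p.X ⊆ q.X := by
  obtain ⟨f, hf, -⟩ := h
  intro x hx
  have h := (f ⟨x, hx⟩).2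
  rwa [hf ⟨x, hx⟩] at h

theorem Le.refl (p : PartialModel K U) : p.Le p :=
  ⟨Embedding.refl L _, fun _ => rfl, StrongEmb.of_surjective p.mem fun x => ⟨x, rfl⟩⟩

theorem Le.trans {p q r : PartialModel K U} (h : p.Le q) (h' : q.Le r) : p.Le r := by
  obtain ⟨f, hf, hf'⟩ := h
  obtain ⟨g, hg, hg'⟩ := h'
  exact ⟨g.comp f, fun x => by simp [hf, hg], hg'.comp hf'⟩

/-- On equal universes the inclusion is an isomorphism. Along a chain, `Le` can thus be read off
from the universes alone. -/
theorem Le.symm_of_subset {p q : PartialModel K U} (h : p.Le q) (hX : q.X ⊆ p.X) : q.Le p := by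
  obtain ⟨f, hf, -⟩ := h
  have hsurj : Function.Surjective f := fun y =>
    ⟨⟨y, hX y.2⟩, Subtype.ext (hf ⟨y, hX y.2⟩)⟩
  let e : p.X ≃[L] q.X :=
    { Equiv.ofBijective f ⟨f.injective, hsurj⟩ with
      map_fun' := fun F x => f.map_fun F x
      map_rel' := fun R x => f.map_rel R x }
  refine ⟨e.symm.toEmbedding, fun y => ?_, StrongEmb.of_surjective p.mem e.symm.surjective⟩
  have h1 : f (e.symm y) = y := e.apply_symm_apply y
  have h2 := hf (e.symm y)
  rw [h1] at h2
  exact h2.symm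

theorem exists_of_injective {N : Type u} [L.Structure N] (hN : K.Mem N) {i : N → U}
    (hi : Function.Injective i) :
    ∃ (q : PartialModel K U) (e : N ≃[L] q.X), ∀ x, (e x : U) = i x := by
  let e : N ≃ Set.range i := Equiv.ofInjective i hi
  let := e.inducedStructure (L := L)
  exact ⟨⟨Set.range i, inferInstance, K.mem_iso e.inducedStructureEquiv hN⟩,
    e.inducedStructureEquiv, fun _ => rfl⟩

section Chain

variable {ι : Type u} [LinearOrder ι]

open Classical in
/-- The structure on the ambient set that extends all the members of a chain. -/
@[reducible]
noncomputable def ambient (P : ι → PartialModel K U) [Nonempty U] : L.Structure U where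
  funMap {_} F xs :=
    if h : ∃ i, ∀ k, xs k ∈ (P i).X then
      (Structure.funMap F (fun k => (⟨xs k, h.choose_spec k⟩ : (P h.choose).X)) : (P h.choose).X)
    else Classical.arbitrary U
  RelMap {_} R xs := ∃ i, ∃ h : ∀ k, xs k ∈ (P i).X,
    Structure.RelMap R (fun k => (⟨xs k, h k⟩ : (P i).X))

variable {P : ι → PartialModel K U}

theorem funMap_eq_of_le {p q : PartialModel K U} (h : p.Le q) {n : ℕ}
    (F : L.Functions n) (xs : Fin n → U) (hp : ∀ k, xs k ∈ p.X) (hq : ∀ k, xs k ∈ q.X) :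
    ((Structure.funMap F (fun k => (⟨xs k, hp k⟩ : p.X)) : p.X) : U) =
      (Structure.funMap F (fun k => (⟨xs k, hq k⟩ : q.X)) : q.X) := by
  obtain ⟨f, hf, -⟩ := h
  rw [← hf, f.map_fun]
  congr 2
  funext k
  exact Subtype.ext (hf _)

theorem relMap_iff_of_le {p q : PartialModel K U} (h : p.Le q) {n : ℕ}
    (R : L.Relations n) (xs : Fin n → U) (hp : ∀ k, xs k ∈ p.X) (hq : ∀ k, xs k ∈ q.X) :
    Structure.RelMap R (fun k => (⟨xs k, hp k⟩ : p.X)) ↔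
      Structure.RelMap R (fun k => (⟨xs k, hq k⟩ : q.X)) := by
  obtain ⟨f, hf, -⟩ := h
  rw [← f.map_rel]
  apply iff_of_eq
  congr 1
  funext k
  exact Subtype.ext (hf _)

theorem ambient_funMap [Nonempty U] (hP : ∀ i j, i ≤ j → (P i).Le (P j)) (i : ι) {n : ℕ}
    (F : L.Functions n) (xs : Fin n → U) (hx : ∀ k, xs k ∈ (P i).X) :
    (ambient P).funMap F xs =
      (Structure.funMap F (fun k => (⟨xs k, hx k⟩ : (P i).X)) : (P i).X) := by
  have h : ∃ i, ∀ k, xs k ∈ (P i).X := ⟨i, hx⟩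
  refine (congrArg _ rfl).trans ((dif_pos h).trans ?_)
  rcases le_total i h.choose with hl | hl
  · exact (funMap_eq_of_le (hP _ _ hl) F xs _ _).symm
  · exact funMap_eq_of_le (hP _ _ hl) F xs _ _

theorem ambient_relMap [Nonempty U] (hP : ∀ i j, i ≤ j → (P i).Le (P j)) (i : ι) {n : ℕ}
    (R : L.Relations n) (xs : Fin n → U) (hx : ∀ k, xs k ∈ (P i).X) :
    (ambient P).RelMap R xs ↔ Structure.RelMap R (fun k => (⟨xs k, hx k⟩ : (P i).X)) := by
  constructor
  · rintro ⟨j, hj, h⟩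
    rcases le_total i j with hl | hl
    · exact (relMap_iff_of_le (hP _ _ hl) R xs _ _).2 h
    · exact (relMap_iff_of_le (hP _ _ hl) R xs _ _).1 h
  · exact fun h => ⟨i, hx, h⟩

/-- The chain axioms speak of substructures of one structure. `ambient` supplies it: on `U` every
member of the chain becomes a substructure, and their supremum is the bound. -/
theorem exists_upper_bound [WellFoundedLT ι] [Nonempty ι] (hP : ∀ i j, i ≤ j → (P i).Le (P j)) :
    ∃ q : PartialModel K U, ∀ i, (P i).Le q := by
  -- `ambient` needs a default value in `U` for tuples contained in no member of the chain; if `U`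
  -- is empty, any member is a bound.
  by_cases hU : Nonempty U
  swap
  · obtain ⟨j⟩ := ‹Nonempty ι›
    refine ⟨P j, fun i => ?_⟩
    rcases le_total i j with hl | hl
    · exact hP _ _ hl
    · exact (hP _ _ hl).symm_of_subset fun x => (hU ⟨x⟩).elim
  let : L.Structure U := ambient P
  let S : ι → L.Substructure U := fun i =>
    { carrier := (P i).X
      fun_mem := fun F xs hx => by
        have := ambient_funMap hP i F xs hx
        rw [this]
        exact Subtype.property _ }
  let e : ∀ i, (P i).X ≃[L] S i := fun i =>
    { Equiv.refl _ with
      map_fun' := fun F xs => Subtype.ext (ambient_funMap hP i F _ fun k => (xs k).2).symm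
      map_rel' := fun R xs => ambient_relMap hP i R _ fun k => (xs k).2 }
  have he : ∀ i x, ((e i x : S i) : U) = x := fun _ _ => rfl
  have hmono : Monotone S := fun i j hij => (hP i j hij).subset
  have hS : ∀ i j, i ≤ j → K.Strong (S j) ((S i).comap (S j).subtype.toHom) := by
    intro i j hij
    obtain ⟨f, hf, hf'⟩ := hP i j hij
    have := K.strong_iso (e j) _ hf'
    convert this using 1
    ext ⟨x, hx⟩
    simp only [Substructure.mem_comap, Substructure.mem_map, Hom.mem_range]
    constructor
    · intro h
      exact ⟨⟨x, hx⟩, ⟨⟨x, h⟩, Subtype.ext (hf _)⟩, rfl⟩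
    · rintro ⟨_, ⟨y, rfl⟩, hy⟩
      have h1 : (x : U) = y := by
        rw [← hf y, ← he j]
        exact (congrArg Subtype.val hy).symm
      change x ∈ (P i).X
      rw [h1]
      exact y.2
  refine ⟨⟨((⨆ i, S i : L.Substructure U) : Set U), inferInstanceAs
    (L.Structure (⨆ i, S i : L.Substructure U)), K.chain_mem S hmono hS⟩, fun j => ?_⟩
  let g : (P j).X ↪[L] (⨆ i, S i : L.Substructure U) :=
    (Substructure.inclusion (le_iSup S j)).comp (e j).toEmbedding
  refine ⟨g, fun _ => rfl, ?_⟩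
  have := K.chain_strong S hmono hS j
  have hg : g.toHom.range = (S j).comap (⨆ i, S i : L.Substructure U).subtype.toHom := by
    ext ⟨x, hx⟩
    simp only [Substructure.mem_comap, Hom.mem_range]
    constructor
    · rintro ⟨y, hy⟩
      have h1 : (y : U) = x := congrArg Subtype.val hy
      change x ∈ (P j).X
      rw [← h1]
      exact y.2
    · intro h
      exact ⟨⟨x, h⟩, rfl⟩
  change K.Strong _ g.toHom.range
  rw [hg]
  exact this

end Chain

end PartialModel

end AbstractElementaryClass

/-- Every nonempty chain of sets has a well-ordered cofinal subset. -/
theorem IsChain.exists_wellFounded_cofinal {α : Type u} {T : Set (Set α)}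
    (hT : IsChain (· ⊆ ·) T) :
    ∃ s ⊆ T, (∀ a ∈ T, ∃ x ∈ s, a ⊆ x) ∧ WellFounded fun x y : s => (x : Set α) ⊂ y := by
  let r : T → T → Prop := WellOrderingRel
  have hr : WellFounded r := WellOrderingRel.isWellOrder.wf
  -- Keep the sets that strictly contain all `r`-earlier ones. The `r`-least set containing a given
  -- `a` is kept, and on kept sets `⊂` implies `r`.
  let s : Set T := {x | ∀ y, r y x → (y : Set α) ⊂ x}
  refine ⟨Subtype.val '' s, by rintro _ ⟨x, -, rfl⟩; exact x.2, ?_, ?_⟩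
  · intro a ha
    let Z : Set T := {x | a ⊆ x}
    have hZ : Z.Nonempty := ⟨⟨a, ha⟩, Set.Subset.refl a⟩
    refine ⟨hr.min Z hZ, ⟨_, ?_, rfl⟩, hr.min_mem Z hZ⟩
    intro y hy
    have h1 : ¬ a ⊆ y := fun h => hr.not_lt_min Z h hy
    have h2 : (y : Set α) ⊆ a := (hT.total ha y.2).resolve_left h1
    exact ⟨h2.trans (hr.min_mem Z hZ), fun h => h1 ((hr.min_mem Z hZ).trans h)⟩
  · have hwf : WellFounded fun x y : Subtype.val '' s =>
        r ⟨x, (by obtain ⟨_, z, -, rfl⟩ := x; exact z.2)⟩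
          ⟨y, (by obtain ⟨_, z, -, rfl⟩ := y; exact z.2)⟩ := InvImage.wf _ hr
    refine Subrelation.wf (fun {x y} hxy => ?_) hwf
    obtain ⟨_, x, hx, rfl⟩ := x
    obtain ⟨_, y, hy, rfl⟩ := y
    rcases trichotomous_of r x y with h | h | h
    · exact h
    · exact (hxy.2 (congrArg Subtype.val h).ge).elim
    · exact absurd (hx _ h) (fun h' => hxy.2 h'.1)

namespace AbstractElementaryClass

open FirstOrder FirstOrder.Language

variable {L : FirstOrder.Language.{v, w}} {K : AbstractElementaryClass.{u} L}

theorem PartialModel.exists_upper_bound_of_isChain {U : Type u} (p₀ : PartialModel K U)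
    (c : Set (PartialModel K U)) (hc : IsChain PartialModel.Le c) :
    ∃ q : PartialModel K U, ∀ p ∈ c, p.Le q := by
  classical
  rcases c.eq_empty_or_nonempty with rfl | hne
  · exact ⟨p₀, by simp⟩
  have htot : ∀ p ∈ c, ∀ q ∈ c, p.X ⊆ q.X → p.Le q := by
    intro p hp q hq h
    by_cases hpq : p = q
    · exact hpq ▸ Le.refl p
    · rcases hc hp hq hpq with h' | h'
      · exact h'
      · exact h'.symm_of_subset h
  have hT : IsChain (· ⊆ ·) (PartialModel.X '' c) := by
    rintro _ ⟨p, hp, rfl⟩ _ ⟨q, hq, rfl⟩ hpq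
    rcases hc hp hq (fun h => hpq (h ▸ rfl)) with h | h
    · exact Or.inl h.subset
    · exact Or.inr h.subset
  obtain ⟨s, hsT, hcof, hwf⟩ := hT.exists_wellFounded_cofinal
  have hsT' : ∀ x : s, ∃ p, p ∈ c ∧ p.X = x := fun x => hsT x.2
  choose P hPc hPX using hsT'
  let : LinearOrder s :=
    { (inferInstance : PartialOrder s) with
      le_total := fun x y => by
        exact hT.total ⟨_, hPc x, hPX x⟩ ⟨_, hPc y, hPX y⟩
      toDecidableLE := Classical.decRel _ }
  have : WellFoundedLT s := ⟨hwf⟩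
  have : Nonempty s := by
    obtain ⟨p, hp⟩ := hne
    obtain ⟨x, hx, -⟩ := hcof _ ⟨p, hp, rfl⟩
    exact ⟨⟨x, hx⟩⟩
  obtain ⟨q, hq⟩ := exists_upper_bound (P := P) fun i j hij =>
    htot _ (hPc i) _ (hPc j) (by rw [hPX i, hPX j]; exact hij)
  refine ⟨q, fun p hp => ?_⟩
  obtain ⟨x, hx, hpx⟩ := hcof _ ⟨p, hp, rfl⟩
  exact (htot p hp _ (hPc ⟨x, hx⟩) (by rw [hPX ⟨x, hx⟩]; exact hpx)).trans (hq ⟨x, hx⟩)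

/-! ### A maximal model by Zorn's lemma -/

/-- A class with a model of cardinality `κ` and none above `κ` has a maximal model of
cardinality `κ`. -/
theorem exists_maximal_model (K : AbstractElementaryClass.{u} L) (κ : Cardinal.{u})
    (hκ : Cardinal.aleph0 ≤ κ)
    (hmodel : ∃ (M : Type u) (_ : L.Structure M), K.Mem M ∧ Cardinal.mk M = κ)
    (hbound : ∀ (M : Type u) [L.Structure M], K.Mem M → Cardinal.mk M ≤ κ) :
    ∃ (M : Type u) (_ : L.Structure M), K.Mem M ∧ Cardinal.mk M = κ ∧
      ∀ (N : Type u) [L.Structure N] (f : M ↪[L] N), K.StrongEmb f → Function.Surjective f := by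
  classical
  obtain ⟨M₀, _, hM₀, hcard⟩ := hmodel
  -- Inside a set of size κ⁺, a model of size at most `κ` leaves room for a copy of each of its
  -- strong extensions.
  let U : Type u := (Order.succ κ).ord.ToType
  have hU : Cardinal.mk U = Order.succ κ := Cardinal.mk_ord_toType _
  obtain ⟨i₀⟩ : Nonempty (M₀ ↪ U) := by
    rw [← Cardinal.le_def, hU, hcard]
    exact Order.le_succ κ
  obtain ⟨p₀, e₀, -⟩ := PartialModel.exists_of_injective hM₀ i₀.injective
  obtain ⟨m, hm⟩ := exists_maximal_of_chains_bounded
    (r := fun p q : {p : PartialModel K U // p₀.Le p} => p.1.Le q.1)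
    (by
      intro c hc
      have hc' : IsChain PartialModel.Le (insert p₀ (Subtype.val '' c)) := by
        refine IsChain.insert ?_ ?_
        · rintro _ ⟨p, hp, rfl⟩ _ ⟨q, hq, rfl⟩ hpq
          exact hc hp hq (fun h => hpq (h ▸ rfl))
        · rintro _ ⟨p, -, rfl⟩ -
          exact Or.inl p.2
      obtain ⟨q, hq⟩ := PartialModel.exists_upper_bound_of_isChain p₀ _ hc'
      exact ⟨⟨q, hq _ (Or.inl rfl)⟩, fun p hp => hq _ (Or.inr ⟨p, hp, rfl⟩)⟩)
    (fun h h' => h.trans h')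
  have hXκ : Cardinal.mk m.1.X ≤ κ := hbound _ m.1.mem
  refine ⟨m.1.X, inferInstance, m.1.mem, le_antisymm hXκ ?_, ?_⟩
  · rw [← hcard, Cardinal.mk_congr e₀.toEquiv]
    exact Cardinal.mk_le_mk_of_subset m.2.subset
  · intro N _ f hf
    by_contra hns
    have hN : K.Mem N := (K.mem_of_strong _ hf).2
    have hcompl : Order.succ κ ≤ Cardinal.mk ↥(m.1.X)ᶜ := by
      by_contra hlt
      rw [not_le, Order.lt_succ_iff] at hlt
      have := Cardinal.mk_sum_compl m.1.X
      have h2 : Cardinal.mk m.1.X + Cardinal.mk ↥(m.1.X)ᶜ ≤ κ :=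
        Cardinal.add_le_of_le hκ hXκ hlt
      rw [this, hU] at h2
      exact absurd h2 (not_le.2 (Order.lt_succ κ))
    obtain ⟨j⟩ : Nonempty (↥(Set.range f)ᶜ ↪ ↥(m.1.X)ᶜ) := by
      rw [← Cardinal.le_def]
      exact ((Cardinal.mk_set_le _).trans (hbound N hN)).trans ((Order.le_succ κ).trans hcompl)
    let fe : m.1.X ≃ Set.range f := Equiv.ofInjective f f.injective
    -- `N` is copied into `U` over `m`: the image of `f` goes back to `m`, the rest goes outside.
    -- Maximality of `m` then leaves no rest.
    let i : N → U := fun x => if h : x ∈ Set.range f then (fe.symm ⟨x, h⟩ : U) else j ⟨x, h⟩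
    have hif : ∀ x, i (f x) = x := by
      intro x
      have h : f x ∈ Set.range f := ⟨x, rfl⟩
      simp only [i, dif_pos h]
      congr 1
      exact fe.symm_apply_apply x
    have hij : ∀ x (h : x ∉ Set.range f), i x = j ⟨x, h⟩ := fun x h => by simp only [i, dif_neg h]
    have hi : Function.Injective i := by
      intro x y hxy
      by_cases hx : x ∈ Set.range f <;> by_cases hy : y ∈ Set.range f
      · obtain ⟨x, rfl⟩ := hx
        obtain ⟨y, rfl⟩ := hy
        rw [hif, hif] at hxy
        rw [Subtype.ext hxy]
      · obtain ⟨x, rfl⟩ := hx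
        rw [hif, hij y hy] at hxy
        exact absurd (hxy ▸ x.2) (j ⟨y, hy⟩).2
      · obtain ⟨y, rfl⟩ := hy
        rw [hif, hij x hx] at hxy
        exact absurd (hxy ▸ y.2) (j ⟨x, hx⟩).2
      · rw [hij x hx, hij y hy] at hxy
        exact congrArg Subtype.val (j.injective (Subtype.ext hxy))
    obtain ⟨q, eL, heL⟩ := PartialModel.exists_of_injective hN hi
    have hle : m.1.Le q := ⟨eL.toEmbedding.comp f, fun x => (heL _).trans (hif x),
      (StrongEmb.of_surjective q.mem eL.surjective).comp hf⟩
    have hsub := (hm ⟨q, m.2.trans hle⟩ hle).subset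
    apply hns
    intro y
    have hy : i y ∈ m.1.X := by
      rw [← heL y]
      exact hsub (eL y).2
    exact ⟨⟨i y, hy⟩, hi (hif ⟨i y, hy⟩)⟩

end AbstractElementaryClass

/-! ### Bounds and closure points in an order of type κ⁺ -/

namespace BipartiteColoring

open Cardinal Set

section SuccessorOrder

variable {Λ : Type u} [LinearOrder Λ] {κ : Cardinal.{u}}

/-- Regularity of κ⁺: an unbounded `Z` would cover `Λ` by at most `κ` initial segments of size at
most `κ`. -/
theorem exists_forall_lt (hκ : ℵ₀ ≤ κ) (hΛ : #Λ = Order.succ κ) (hI : ∀ x : Λ, #(Iio x) ≤ κ)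
    (Z : Set Λ) (hZ : #Z ≤ κ) : ∃ x, ∀ z ∈ Z, z < x := by
  by_contra! h
  have hcover : (univ : Set Λ) ⊆ ⋃ z : Z, Iic (z : Λ) := by
    intro x _
    obtain ⟨z, hz, hxz⟩ := h x
    exact mem_iUnion.2 ⟨⟨z, hz⟩, hxz⟩
  have hIic : ∀ z : Λ, #(Iic z) ≤ κ := by
    intro z
    rw [← Iio_insert]
    exact (mk_insert_le).trans (add_le_of_le hκ (hI z) (one_le_aleph0.trans hκ))
  have h1 : #Λ ≤ κ := by
    rw [← mk_univ]
    refine (mk_le_mk_of_subset hcover).trans ((mk_iUnion_le _).trans ?_)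
    refine (mul_le_mul' hZ (ciSup_le' fun z : Z => hIic z)).trans ?_
    rw [mul_eq_self hκ]
  rw [hΛ] at h1
  exact absurd h1 (not_le.2 (Order.lt_succ κ))

/-- A map onto `T` all of whose fibres are unbounded. -/
theorem exists_unbounded_fibres (hκ : ℵ₀ ≤ κ) (hΛ : #Λ = Order.succ κ)
    (hI : ∀ x : Λ, #(Iio x) ≤ κ) (T : Type u) [Nonempty T] (hT : #T ≤ Order.succ κ) :
    ∃ t : Λ → T, ∀ y w, ∃ x, w < x ∧ t x = y := by
  have hκ' : ℵ₀ ≤ Order.succ κ := hκ.trans (Order.le_succ κ)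
  obtain ⟨e⟩ : Nonempty (Λ ≃ Λ × T) := by
    rw [← Cardinal.eq, mk_prod, lift_id, lift_id, hΛ]
    exact (mul_eq_left hκ' hT (mk_ne_zero T)).symm
  refine ⟨fun x => (e x).2, fun y w => ?_⟩
  by_contra! h
  have h1 : ∀ l : Λ, e.symm (l, y) ≤ w := fun l => by
    by_contra hl
    exact h _ (not_le.1 hl) (by simp)
  have h2 : #Λ ≤ #(Iic w) :=
    mk_le_of_injective (f := fun l => (⟨e.symm (l, y), h1 l⟩ : Iic w)) fun a b hab => by
      simpa using congrArg Subtype.val hab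
  rw [← Iio_insert, hΛ] at h2
  have h3 := h2.trans ((mk_insert_le).trans
    (add_le_of_le hκ (hI w) (one_le_aleph0.trans hκ)))
  exact absurd h3 (not_le.2 (Order.lt_succ κ))

theorem exists_closed [WellFoundedLT Λ] (hκ : ℵ₀ ≤ κ) (hΛ : #Λ = Order.succ κ)
    (hI : ∀ x : Λ, #(Iio x) ≤ κ) (g : Λ → Set Λ) (hg : ∀ x, #(g x) ≤ κ) (a : Λ) :
    ∃ b, a ≤ b ∧ ∀ x < b, ∀ y ∈ g x, y < b := by
  have hstep : ∀ x, ∃ x', x < x' ∧ ∀ y < x, ∀ z ∈ g y, z < x' := by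
    intro x
    obtain ⟨x', hx'⟩ := exists_forall_lt hκ hΛ hI (insert x (⋃ y : Iio x, g y)) (by
      refine mk_insert_le.trans (add_le_of_le hκ ?_ (one_le_aleph0.trans hκ))
      refine (mk_iUnion_le _).trans ((mul_le_mul' (hI x) (ciSup_le' fun z : Iio x => hg z)).trans ?_)
      rw [mul_eq_self hκ])
    exact ⟨x', hx' x (mem_insert _ _), fun y hy z hz =>
      hx' z (mem_insert_of_mem _ (mem_iUnion.2 ⟨⟨y, hy⟩, hz⟩))⟩
  choose h hlt hh using hstep
  -- The closure point is the supremum of the iterates of `h`: anything below it lies below some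
  -- iterate, and the next iterate bounds its `g`-image.
  let B : Set Λ := {b | ∀ n : ℕ, h^[n] a ≤ b}
  have hB : B.Nonempty := by
    obtain ⟨b, hb⟩ := exists_forall_lt hκ hΛ hI (range fun n : ULift.{u} ℕ => h^[n.down] a)
      (mk_range_le.trans (by simpa using hκ))
    exact ⟨b, fun n => (hb _ ⟨⟨n⟩, rfl⟩).le⟩
  have hwf : WellFounded ((· < ·) : Λ → Λ → Prop) := wellFounded_lt
  refine ⟨hwf.min B hB, hwf.min_mem B hB 0, fun x hx y hy => ?_⟩
  have hxB : x ∉ B := fun h' => hwf.not_lt_min B h' hx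
  obtain ⟨n, hn⟩ : ∃ n : ℕ, x < h^[n] a := by simpa [B] using hxB
  refine (hh _ x hn y hy).trans_le ?_
  rw [← Function.iterate_succ_apply' h n a]
  exact hwf.min_mem B hB (n + 1)

end SuccessorOrder

/-! ### The recursive coloring -/

section Recursion

variable {Λ D : Type u}

theorem exists_fixedPoint [LinearOrder Λ] [WellFoundedLT Λ] (Ψ : (Λ → Prop) → Λ → Prop)
    (hΨ : ∀ φ φ' x, (∀ y < x, φ y ↔ φ' y) → (Ψ φ x ↔ Ψ φ' x)) : ∃ φ, ∀ x, φ x ↔ Ψ φ x := by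
  have hwf : WellFounded ((· < ·) : Λ → Λ → Prop) := wellFounded_lt
  let φ : Λ → Prop := hwf.fix fun x r => Ψ (fun y => ∃ h : y < x, r y h) x
  refine ⟨φ, fun x => ?_⟩
  have h : φ x = Ψ (fun y => ∃ _ : y < x, φ y) x := hwf.fix_eq _ x
  rw [h]
  exact hΨ _ _ _ fun y hy => ⟨fun ⟨_, h⟩ => h, fun h => ⟨hy, h⟩⟩

theorem exists_injOn_surjOn {κ : Cardinal.{u}} (hκ : ℵ₀ ≤ κ) (hD : #D = κ) (Z : Set Λ)
    (hZ : #Z ≤ κ) :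
    ∃ f : Λ → D, InjOn f Z ∧ (κ ≤ #Z → ∀ d, ∃ y ∈ Z, f y = d) := by
  classical
  have : Nonempty D := mk_ne_zero_iff.1 (by rw [hD]; exact (aleph0_pos.trans_le hκ).ne')
  obtain ⟨i, hi⟩ : ∃ i : Z ↪ D, κ ≤ #Z → Function.Surjective i := by
    by_cases h : κ ≤ #Z
    · obtain ⟨e⟩ : Nonempty (Z ≃ D) := by
        rw [← Cardinal.eq, hD]
        exact le_antisymm hZ h
      exact ⟨e.toEmbedding, fun _ => e.surjective⟩
    · obtain ⟨i⟩ : Nonempty (Z ↪ D) := by rwa [← Cardinal.le_def, hD]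
      exact ⟨i, fun h' => absurd h' h⟩
  let f : Λ → D := fun x => if h : x ∈ Z then i ⟨x, h⟩ else Classical.arbitrary D
  have hf : ∀ x (h : x ∈ Z), f x = i ⟨x, h⟩ := fun x h => dif_pos h
  refine ⟨f, fun x hx y hy hxy => ?_, fun h d => ?_⟩
  · rw [hf x hx, hf y hy] at hxy
    exact congrArg Subtype.val (i.injective hxy)
  · obtain ⟨⟨y, hy⟩, rfl⟩ := hi h d
    exact ⟨y, hy, hf y hy⟩

/-- Inject `Z \ {g}` into `D`, move the color of `b` to `c` by a transposition, and then give `g`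
the color `c` as well. -/
theorem exists_almost_injOn_surjOn {κ : Cardinal.{u}} (hκ : ℵ₀ ≤ κ) (hD : #D = κ) (Z : Set Λ)
    (hZ : #Z ≤ κ) (b g : Λ) (hb : b ∈ Z) (hbg : b ≠ g) (c : D) :
    ∃ f : Λ → D, f b = c ∧ f g = c ∧
      (∀ y ∈ Z, ∀ z ∈ Z, f y = f z → y = z ∨ (y = b ∧ z = g) ∨ (y = g ∧ z = b)) ∧
      (κ ≤ #Z → ∀ d, ∃ y ∈ Z, f y = d) := by
  classical
  obtain ⟨i, hi, hi'⟩ := exists_injOn_surjOn hκ hD (Z \ {g})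
    ((mk_le_mk_of_subset sdiff_subset).trans hZ)
  let f : Λ → D := fun y => if y = g then c else Equiv.swap (i b) c (i y)
  have hfg : f g = c := if_pos rfl
  have hf : ∀ y, y ≠ g → f y = Equiv.swap (i b) c (i y) := fun y hy => if_neg hy
  have hfb : f b = c := by rw [hf b hbg, Equiv.swap_apply_left]
  have hinj : ∀ y ∈ Z, y ≠ g → ∀ z ∈ Z, z ≠ g → f y = f z → y = z := by
    intro y hy hyg z hz hzg h
    rw [hf y hyg, hf z hzg] at h
    exact hi ⟨hy, hyg⟩ ⟨hz, hzg⟩ ((Equiv.swap (i b) c).injective h)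
  refine ⟨f, hfb, hfg, ?_, ?_⟩
  · intro y hy z hz h
    by_cases hyg : y = g <;> by_cases hzg : z = g
    · exact Or.inl (hyg.trans hzg.symm)
    · refine Or.inr (Or.inr ⟨hyg, ?_⟩)
      refine hinj z hz hzg b hb hbg ?_
      rw [← h, hyg, hfg, hfb]
    · refine Or.inr (Or.inl ⟨?_, hzg⟩)
      refine hinj y hy hyg b hb hbg ?_
      rw [h, hzg, hfg, hfb]
    · exact Or.inl (hinj y hy hyg z hz hzg h)
  · intro h d
    have hcard : κ ≤ #↥(Z \ {g}) := by
      by_contra! hlt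
      have h1 : Z ⊆ insert g (Z \ {g}) := by
        intro x hx
        by_cases hxg : x = g
        · exact Or.inl hxg
        · exact Or.inr ⟨hx, hxg⟩
      have h2 := (mk_le_mk_of_subset h1).trans mk_insert_le
      have h3 := add_lt_of_lt hκ hlt (one_lt_aleph0.trans_le hκ)
      exact absurd (h.trans h2) (not_le.2 h3)
    obtain ⟨y, hy, hyd⟩ := hi' hcard ((Equiv.swap (i b) c).symm d)
    exact ⟨y, hy.1, by rw [hf y hy.2, hyd, Equiv.apply_symm_apply]⟩

variable [LinearOrder Λ]

open Classical in
/-- The symmetric coloring in which each vertex `a` colors the pairs `{a, b}` with `b < a`,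
using `q a` if `φ a` holds and `p a` otherwise. -/
noncomputable def edge (p q : Λ → Λ → D) (φ : Λ → Prop) (a b : Λ) : D :=
  if b < a then (if φ a then q a b else p a b) else (if φ b then q b a else p b a)

theorem edge_comm (p q : Λ → Λ → D) (φ : Λ → Prop) (a b : Λ) :
    edge p q φ a b = edge p q φ b a := by
  rcases lt_trichotomy a b with h | rfl | h
  · simp only [edge, if_pos h, if_neg h.not_gt]
  · rfl
  · simp only [edge, if_pos h, if_neg h.not_gt]

theorem edge_of_lt_of_pos (p q : Λ → Λ → D) {φ : Λ → Prop} {a b : Λ} (h : b < a) (ha : φ a) :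
    edge p q φ a b = q a b := by
  simp only [edge, if_pos h, if_pos ha]

theorem edge_of_lt_of_neg (p q : Λ → Λ → D) {φ : Λ → Prop} {a b : Λ} (h : b < a) (ha : ¬ φ a) :
    edge p q φ a b = p a b := by
  simp only [edge, if_pos h, if_neg ha]

theorem edge_congr (p q : Λ → Λ → D) {φ φ' : Λ → Prop} {a b : Λ} (ha : φ a ↔ φ' a)
    (hb : φ b ↔ φ' b) : edge p q φ a b = edge p q φ' a b := by
  unfold edge
  split_ifs <;> first | rfl | (exfalso; tauto)

/-- The coloring built by recursion: a vertex colors its predecessors injectively, except that it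
may give one prescribed color to one prescribed pair that has no common neighbor yet. -/
theorem exists_recursive_coloring [WellFoundedLT Λ] {κ : Cardinal.{u}} (hκ : ℵ₀ ≤ κ)
    (hΛ : #Λ = Order.succ κ) (hI : ∀ x : Λ, #(Iio x) ≤ κ) (hD : #D = κ) :
    ∃ G : Λ → Λ → D, (∀ x y, G x y = G y x) ∧
      (∀ x, InjOn (G x) (Iio x) ∨ ∃ b g c, b < g ∧ (∃ w, g < w ∧ w < x) ∧
        (∀ a < x, a ≠ b → a ≠ g → G a b = c → G a g ≠ c) ∧ G x b = c ∧
        (∀ y < x, ∀ z < x, G x y = G x z → y = z ∨ (y = b ∧ z = g) ∨ (y = g ∧ z = b))) ∧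
      (∀ b g c, b < g → ∃ a, a ≠ b ∧ a ≠ g ∧ G a b = c ∧ G a g = c) ∧
      (∃ x₀, ∀ x, x₀ ≤ x → ∀ d, ∃ y < x, G x y = d) := by
  classical
  have hκ' : ℵ₀ ≤ Order.succ κ := hκ.trans (Order.le_succ κ)
  have : Nonempty D := mk_ne_zero_iff.1 (by rw [hD]; exact (aleph0_pos.trans_le hκ).ne')
  have : Nonempty Λ := mk_ne_zero_iff.1 (by rw [hΛ]; exact (aleph0_pos.trans_le hκ').ne')
  -- Bookkeeping: vertex `x` is assigned the task `t x = (b, g, c)`, and every task recurs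
  -- unboundedly often.
  obtain ⟨t, ht⟩ := exists_unbounded_fibres hκ hΛ hI (Λ × Λ × D) (by
    simp only [mk_prod, lift_id, hΛ, hD]
    exact mul_le_of_le hκ' le_rfl (mul_le_of_le hκ' le_rfl (Order.le_succ κ)))
  obtain ⟨x₀, hx₀⟩ : ∃ x₀ : Λ, ∀ x, x₀ ≤ x → κ ≤ #(Iio x) := by
    obtain ⟨Z, hZ⟩ := le_mk_iff_exists_set.1 (hΛ ▸ Order.le_succ κ : κ ≤ #Λ)
    obtain ⟨x₀, h⟩ := exists_forall_lt hκ hΛ hI Z hZ.le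
    exact ⟨x₀, fun x hx => hZ ▸ mk_le_mk_of_subset fun z hz => (h z hz).trans_le hx⟩
  choose p hp hp' using fun x : Λ => exists_injOn_surjOn hκ hD (Iio x) (hI x)
  have hq₀ : ∀ x : Λ, ∃ f : Λ → D, (t x).1 < (t x).2.1 → (t x).2.1 < x →
      f (t x).1 = (t x).2.2 ∧ f (t x).2.1 = (t x).2.2 ∧
      (∀ y ∈ Iio x, ∀ z ∈ Iio x, f y = f z →
        y = z ∨ (y = (t x).1 ∧ z = (t x).2.1) ∨ (y = (t x).2.1 ∧ z = (t x).1)) ∧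
      (κ ≤ #(Iio x) → ∀ d, ∃ y ∈ Iio x, f y = d) := by
    intro x
    by_cases h : (t x).1 < (t x).2.1 ∧ (t x).2.1 < x
    · obtain ⟨f, hf⟩ := exists_almost_injOn_surjOn hκ hD (Iio x) (hI x) (t x).1 (t x).2.1
        (h.1.trans h.2) h.1.ne (t x).2.2
      exact ⟨f, fun _ _ => hf⟩
    · exact ⟨p x, fun h1 h2 => absurd ⟨h1, h2⟩ h⟩
  choose q hq using hq₀
  -- Both candidate rows `p x` and `q x` are fixed in advance, so the recursion only decides whether
  -- `x` performs its task: it does so if no other vertex below `x` has. The gap `w` between `g` and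
  -- `x` serves to recognize the order later.
  obtain ⟨φ, hφ⟩ := exists_fixedPoint (Λ := Λ)
    (fun φ x => (t x).1 < (t x).2.1 ∧ (∃ w, (t x).2.1 < w ∧ w < x) ∧
      ∀ a < x, a ≠ (t x).1 → a ≠ (t x).2.1 → edge p q φ a (t x).1 = (t x).2.2 →
        edge p q φ a (t x).2.1 ≠ (t x).2.2) (by
    intro φ φ' x h
    refine and_congr_right fun hbg => and_congr_right fun ⟨w, hw, hwx⟩ => ?_
    refine forall₂_congr fun a ha => ?_
    rw [edge_congr p q (h a ha) (h _ (hbg.trans (hw.trans hwx))),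
      edge_congr p q (h a ha) (h _ (hw.trans hwx))])
  have hpos : ∀ x y, y < x → φ x → edge p q φ x y = q x y :=
    fun x y h hx => edge_of_lt_of_pos p q h hx
  have hneg : ∀ x y, y < x → ¬ φ x → edge p q φ x y = p x y :=
    fun x y h hx => edge_of_lt_of_neg p q h hx
  refine ⟨edge p q φ, edge_comm p q φ, ?_, ?_, x₀, ?_⟩
  · intro x
    by_cases hx : φ x
    · right
      obtain ⟨hbg, ⟨w, hgw, hwx⟩, hfresh⟩ := (hφ x).1 hx
      have hgx := hgw.trans hwx
      obtain ⟨h1, h2, h3, -⟩ := hq x hbg hgx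
      refine ⟨(t x).1, (t x).2.1, (t x).2.2, hbg, ⟨w, hgw, hwx⟩, hfresh, ?_, ?_⟩
      · rw [hpos x _ (hbg.trans hgx) hx, h1]
      · intro y hy z hz h
        rw [hpos x y hy hx, hpos x z hz hx] at h
        exact h3 y hy z hz h
    · left
      intro y hy z hz h
      rw [hneg x y hy hx, hneg x z hz hx] at h
      exact hp x hy hz h
  · intro b g c hbg
    obtain ⟨w, hgw, -⟩ := ht (b, g, c) g
    obtain ⟨x, hwx, hx⟩ := ht (b, g, c) w
    by_cases hxφ : φ x
    · have hgx := hgw.trans hwx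
      have h := hq x
      rw [hx] at h
      obtain ⟨h1, h2, -⟩ := h hbg hgx
      refine ⟨x, (hbg.trans hgx).ne', hgx.ne', ?_, ?_⟩
      · rw [hpos x _ (hbg.trans hgx) hxφ, h1]
      · rw [hpos x _ hgx hxφ, h2]
    · rw [hφ x, hx] at hxφ
      simp only [not_and, not_forall, not_not] at hxφ
      obtain ⟨a, -, h1, h2, h3, h4⟩ := hxφ hbg ⟨w, hgw, hwx⟩
      exact ⟨a, h1, h2, h3, h4⟩
  · intro x hx d
    by_cases hxφ : φ x
    · obtain ⟨hbg, ⟨w, hgw, hwx⟩, -⟩ := (hφ x).1 hxφ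
      obtain ⟨y, hy, hyd⟩ := (hq x hbg (hgw.trans hwx)).2.2.2 (hx₀ x hx) d
      exact ⟨y, hy, by rw [hpos x y hy hxφ, hyd]⟩
    · obtain ⟨y, hy, hyd⟩ := hp' x (hx₀ x hx) d
      exact ⟨y, hy, by rw [hneg x y hy hxφ, hyd]⟩

/-- A symmetric coloring without monochromatic `K_{2,2}` off the diagonal in which any two vertices
have a common neighbor of every color, and whose order can be recognized on a tail. -/
theorem exists_symmetric_coloring [WellFoundedLT Λ] {κ : Cardinal.{u}} (hκ : ℵ₀ ≤ κ)
    (hΛ : #Λ = Order.succ κ) (hI : ∀ x : Λ, #(Iio x) ≤ κ) (hD : #D = κ) :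
    ∃ G : Λ → Λ → D, (∀ x y, G x y = G y x) ∧
      (∀ a₁ a₂ b₁ b₂ c, a₁ ≠ a₂ → b₁ ≠ b₂ → a₁ ≠ b₁ → a₁ ≠ b₂ → a₂ ≠ b₁ → a₂ ≠ b₂ →
        G a₁ b₁ = c → G a₁ b₂ = c → G a₂ b₁ = c → G a₂ b₂ ≠ c) ∧
      (∀ b g c, b ≠ g → ∃ a, a ≠ b ∧ a ≠ g ∧ G a b = c ∧ G a g = c) ∧
      (∃ x₀, ∀ δ, x₀ ≤ δ → ∀ x, δ ≤ x → ((∀ d, ∃ y < δ, G x y = d) ↔ x = δ)) := by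
  obtain ⟨G, hsymm, hloc, hcommon, x₀, honto⟩ := exists_recursive_coloring hκ hΛ hI hD
  refine ⟨G, hsymm, ?_, ?_, x₀, ?_⟩
  -- Let `x` be the largest vertex of a monochromatic K₂,₂. Its two neighbors there must be its
  -- prescribed pair, but the fourth vertex is an earlier common neighbor in the same color.
  · have key : ∀ x a y z c, y < x → z < x → a < x → y ≠ z → a ≠ y → a ≠ z →
        G x y = c → G x z = c → G a y = c → G a z ≠ c := by
      intro x a y z c hy hz ha hyz hay haz h1 h2 h3 h4
      rcases hloc x with h | ⟨b, g, c', hbg, -, hfresh, hc', hinj⟩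
      · exact hyz (h hy hz (h1.trans h2.symm))
      · rcases hinj y hy z hz (h1.trans h2.symm) with h | ⟨rfl, rfl⟩ | ⟨rfl, rfl⟩
        · exact hyz h
        · exact hfresh a ha hay haz (by rw [h3, ← h1, hc']) (by rw [h4, ← h1, hc'])
        · exact hfresh a ha haz hay (by rw [h4, ← h2, hc']) (by rw [h3, ← h2, hc'])
    intro a₁ a₂ b₁ b₂ c ha hb h11 h12 h21 h22 e11 e12 e21 e22
    have f11 := (hsymm b₁ a₁).trans e11
    have f12 := (hsymm b₂ a₁).trans e12
    have f21 := (hsymm b₁ a₂).trans e21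
    have f22 := (hsymm b₂ a₂).trans e22
    have cases : (b₁ < a₁ ∧ b₂ < a₁ ∧ a₂ < a₁) ∨ (b₁ < a₂ ∧ b₂ < a₂ ∧ a₁ < a₂) ∨
        (a₁ < b₁ ∧ a₂ < b₁ ∧ b₂ < b₁) ∨ (a₁ < b₂ ∧ a₂ < b₂ ∧ b₁ < b₂) := by
      rcases lt_or_gt_of_ne ha with h | h <;> rcases lt_or_gt_of_ne hb with h' | h' <;>
      rcases lt_or_gt_of_ne h11 with k11 | k11 <;> rcases lt_or_gt_of_ne h12 with k12 | k12 <;>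
      rcases lt_or_gt_of_ne h21 with k21 | k21 <;> rcases lt_or_gt_of_ne h22 with k22 | k22 <;>
      first
        | exact Or.inl ⟨k11, k12, h⟩
        | exact Or.inr (Or.inl ⟨k21, k22, h⟩)
        | exact Or.inr (Or.inr (Or.inl ⟨k11, k21, h'⟩))
        | exact Or.inr (Or.inr (Or.inr ⟨k12, k22, h'⟩))
        | order
    rcases cases with ⟨h1, h2, h3⟩ | ⟨h1, h2, h3⟩ | ⟨h1, h2, h3⟩ | ⟨h1, h2, h3⟩
    · exact key a₁ a₂ b₁ b₂ c h1 h2 h3 hb h21 h22 e11 e12 e21 e22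
    · exact key a₂ a₁ b₁ b₂ c h1 h2 h3 hb h11 h12 e21 e22 e11 e12
    · exact key b₁ b₂ a₁ a₂ c h1 h2 h3 ha h12.symm h22.symm f11 f21 f12 f22
    · exact key b₂ b₁ a₁ a₂ c h1 h2 h3 ha h11.symm h21.symm f12 f22 f11 f21
  · intro b g c hbg
    rcases lt_or_gt_of_ne hbg with h | h
    · exact hcommon b g c h
    · obtain ⟨a, h1, h2, h3, h4⟩ := hcommon g b c h
      exact ⟨a, h2, h1, h4, h3⟩
  · intro δ hδ x hx
    refine ⟨fun h => ?_, fun h => h ▸ honto δ hδ⟩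
    by_contra hne
    have hlt : δ < x := lt_of_le_of_ne hx (Ne.symm hne)
    -- If `x > δ` also saw all colors below `δ`, the color of `δ` would be repeated, forcing `δ =
    -- g`. The color of `w > g` would then be repeated too, but `x` repeats a color only on `{b,
    -- g}`.
    obtain ⟨z, hz, hzδ⟩ := h (G x δ)
    rcases hloc x with hinj | ⟨b, g, c, hbg, ⟨w, hgw, hwx⟩, -, -, hinj⟩
    · exact hz.ne (hinj (hz.trans hlt) hlt hzδ)
    · rcases hinj z (hz.trans hlt) δ hlt hzδ with h' | ⟨rfl, rfl⟩ | ⟨rfl, rfl⟩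
      · exact hz.ne h'
      · obtain ⟨y, hy, hyw⟩ := h (G x w)
        rcases hinj y (hy.trans hlt) w hwx hyw with h' | ⟨-, h'⟩ | ⟨h', -⟩
        · exact (hy.trans hgw).ne h'
        · exact hgw.ne' h'
        · exact hy.ne h'
      · exact hz.not_gt hbg

end Recursion

end BipartiteColoring

/-! ### Coding subsets on the diagonal, and rigidity on a tail -/

namespace BipartiteColoring

open Cardinal Set

variable {Λ D : Type u}

open Classical in
/-- The coloring that extends `G` by two vertices on each side, joined to all the old vertices in
their own colors; these two colors also color the diagonal, according to `s`. -/
noncomputable def extend (G : Λ → Λ → D) (d₀ d₁ : D) (s : Λ → Bool) :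
    Bool ⊕ Λ → Bool ⊕ Λ → Bool ⊕ D
  | .inl i, .inl j => .inr (if i = j then d₀ else d₁)
  | .inl i, .inr _ => .inl i
  | .inr _, .inl j => .inl j
  | .inr x, .inr y => if x = y then .inl (s x) else .inr (G x y)

section

variable {G : Λ → Λ → D} {d₀ d₁ : D} {s t : Λ → Bool}

theorem extend_diag (x : Λ) : extend G d₀ d₁ s (.inr x) (.inr x) = .inl (s x) := if_pos rfl

theorem extend_of_ne {x y : Λ} (h : x ≠ y) :
    extend G d₀ d₁ s (.inr x) (.inr y) = .inr (G x y) := if_neg h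

theorem eq_of_extend_eq_inl {x y : Λ} {i : Bool}
    (h : extend G d₀ d₁ s (.inr x) (.inr y) = .inl i) : x = y := by
  by_contra hne
  rw [extend_of_ne hne] at h
  cases h

theorem extend_eq_inr_iff {x y : Λ} {d : D} :
    extend G d₀ d₁ s (.inr x) (.inr y) = .inr d ↔ x ≠ y ∧ G x y = d := by
  by_cases h : x = y
  · subst h
    simp [extend_diag]
  · simp [extend_of_ne h, h]

theorem extend_comm (hG : ∀ x y, G x y = G y x) (v w : Bool ⊕ Λ) :
    extend G d₀ d₁ s v w = extend G d₀ d₁ s w v := by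
  rcases v with i | x <;> rcases w with j | y
  · simp only [extend, eq_comm]
  · rfl
  · rfl
  · by_cases h : x = y
    · rw [h]
    · rw [extend_of_ne h, extend_of_ne (Ne.symm h), hG]

/-- In an extra color, two old vertices share only one added neighbor, and an old and an added
vertex share at most the diagonal partner. In an old color, old and added vertices are not joined;
the added 2 × 2 block is saved by `d₀ ≠ d₁`. -/
theorem extend_no_mono (hd : d₀ ≠ d₁)
    (hmono : ∀ a₁ a₂ b₁ b₂ c, a₁ ≠ a₂ → b₁ ≠ b₂ → a₁ ≠ b₁ → a₁ ≠ b₂ → a₂ ≠ b₁ → a₂ ≠ b₂ →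
        G a₁ b₁ = c → G a₁ b₂ = c → G a₂ b₁ = c → G a₂ b₂ ≠ c)
    (a₁ a₂ b₁ b₂ : Bool ⊕ Λ) (c : Bool ⊕ D) (ha : a₁ ≠ a₂) (hb : b₁ ≠ b₂)
    (h11 : extend G d₀ d₁ s a₁ b₁ = c) (h12 : extend G d₀ d₁ s a₁ b₂ = c)
    (h21 : extend G d₀ d₁ s a₂ b₁ = c) (h22 : extend G d₀ d₁ s a₂ b₂ = c) : False := by
  rcases c with k | d
  · rcases a₁ with i₁ | x₁ <;> rcases a₂ with i₂ | x₂ <;> rcases b₁ with j₁ | y₁ <;>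
      rcases b₂ with j₂ | y₂ <;>
      first
        | cases h11; done
        | cases h12; done
        | cases h21; done
        | cases h22; done
        | skip
    · exact ha (congrArg Sum.inl (Sum.inl.inj (h11.trans h21.symm)))
    · exact hb (congrArg Sum.inr
        ((eq_of_extend_eq_inl h21).symm.trans (eq_of_extend_eq_inl h22)))
    · exact hb (congrArg Sum.inr
        ((eq_of_extend_eq_inl h11).symm.trans (eq_of_extend_eq_inl h12)))
    · exact hb (congrArg Sum.inl (Sum.inl.inj (h11.trans h12.symm)))
    · exact ha (congrArg Sum.inr
        ((eq_of_extend_eq_inl h12).trans (eq_of_extend_eq_inl h22).symm))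
    · exact ha (congrArg Sum.inr
        ((eq_of_extend_eq_inl h11).trans (eq_of_extend_eq_inl h21).symm))
    · exact ha (congrArg Sum.inr
        ((eq_of_extend_eq_inl h11).trans (eq_of_extend_eq_inl h21).symm))
  · rcases a₁ with i₁ | x₁ <;> rcases a₂ with i₂ | x₂ <;> rcases b₁ with j₁ | y₁ <;>
      rcases b₂ with j₂ | y₂ <;>
      first
        | cases h11; done
        | cases h12; done
        | cases h21; done
        | cases h22; done
        | skip
    · have h1 := Sum.inr.inj (h11.trans h21.symm)
      have hne : i₁ ≠ i₂ := fun h => ha (congrArg _ h)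
      split_ifs at h1 with e1 e2 e2
      · exact hne (e1.trans e2.symm)
      · exact hd h1
      · exact hd h1.symm
      · revert hne e1 e2
        cases i₁ <;> cases i₂ <;> cases j₁ <;> simp
    · obtain ⟨n11, e11⟩ := extend_eq_inr_iff.1 h11
      obtain ⟨n12, e12⟩ := extend_eq_inr_iff.1 h12
      obtain ⟨n21, e21⟩ := extend_eq_inr_iff.1 h21
      obtain ⟨n22, e22⟩ := extend_eq_inr_iff.1 h22
      exact hmono _ _ _ _ d (fun h => ha (congrArg _ h)) (fun h => hb (congrArg _ h))
        n11 n12 n21 n22 e11 e12 e21 e22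

theorem extend_common (hcommon : ∀ b g c, b ≠ g → ∃ a, a ≠ b ∧ a ≠ g ∧ G a b = c ∧ G a g = c)
    (y z : Λ) (hyz : y ≠ z) (c : Bool ⊕ D) :
    ∃ a, extend G d₀ d₁ s a (.inr y) = c ∧ extend G d₀ d₁ s a (.inr z) = c := by
  rcases c with k | d
  · exact ⟨.inl k, rfl, rfl⟩
  · obtain ⟨a, h1, h2, h3, h4⟩ := hcommon y z d hyz
    exact ⟨.inr a, extend_eq_inr_iff.2 ⟨h1, h3⟩, extend_eq_inr_iff.2 ⟨h2, h4⟩⟩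

/-- The vertices below `δ`, the added vertices included. -/
def Below [LT Λ] (δ : Λ) (v : Bool ⊕ Λ) : Prop := ∀ x, v = .inr x → x < δ

theorem below_inr [LT Λ] {δ x : Λ} : Below δ (Sum.inr x) ↔ x < δ :=
  ⟨fun h => h x rfl, fun h _ hy => Sum.inr.inj hy ▸ h⟩

theorem below_inl [LT Λ] {δ : Λ} {i : Bool} : Below δ (Sum.inl i) := fun _ h => by cases h

variable [LinearOrder Λ]

/-- All colors occur between `δ` and the vertices below it, the extra ones through added vertices.
As `g` keeps these vertices below `δ`, the image of `δ` sees all of `D` below `δ`, and `hrec`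
identifies it. -/
theorem map_eq_of_below {δ : Λ}
    (hrec : ∀ x, δ ≤ x → ((∀ d, ∃ y < δ, G x y = d) ↔ x = δ))
    (f g : (Bool ⊕ Λ) ≃ (Bool ⊕ Λ)) (π : (Bool ⊕ D) ≃ (Bool ⊕ D))
    (h : ∀ v w, extend G d₀ d₁ t (f v) (g w) = π (extend G d₀ d₁ s v w))
    (hf : ∀ v, Below δ v → Below δ (f.symm v)) (hg : ∀ v, Below δ v → Below δ (g v)) :
    f (.inr δ) = .inr δ := by
  have hnot : ¬ Below δ (f (.inr δ)) := by
    intro hb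
    have := hf _ hb
    rw [Equiv.symm_apply_apply, below_inr] at this
    exact this.false
  obtain ⟨x, hx⟩ : ∃ x, f (.inr δ) = .inr x := by
    rcases hfx : f (.inr δ) with i | x
    · rw [hfx] at hnot
      exact absurd below_inl hnot
    · exact ⟨x, rfl⟩
  rw [hx, below_inr, not_lt] at hnot
  rw [hx]
  refine congrArg _ ((hrec x hnot).1 fun d => ?_)
  obtain ⟨w, hw, hwc⟩ : ∃ w, Below δ w ∧
      extend G d₀ d₁ s (.inr δ) w = π.symm (.inr d) := by
    rcases π.symm (.inr d) with i | e
    · exact ⟨.inl i, below_inl, rfl⟩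
    · obtain ⟨y, hy, hye⟩ := (hrec δ le_rfl).2 rfl e
      exact ⟨.inr y, below_inr.2 hy, extend_eq_inr_iff.2 ⟨hy.ne', hye⟩⟩
  have h1 := h (.inr δ) w
  rw [hwc, hx, Equiv.apply_symm_apply] at h1
  have h2 := hg w hw
  rcases hgw : g w with j | y
  · rw [hgw] at h1
    cases h1
  · rw [hgw] at h1 h2
    exact ⟨y, below_inr.1 h2, (extend_eq_inr_iff.1 h1).2⟩

theorem below_of_fixed {δ₁ δ : Λ} (hδ : δ₁ ≤ δ) (f : Bool ⊕ Λ → Bool ⊕ Λ)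
    (hf : ∀ v, Below δ₁ v → Below δ₁ (f v)) (hfix : ∀ x, δ₁ ≤ x → x < δ → f (.inr x) = .inr x)
    (v : Bool ⊕ Λ) (hv : Below δ v) : Below δ (f v) := by
  by_cases hv₁ : Below δ₁ v
  · exact fun x hx => (hf v hv₁ x hx).trans_le hδ
  · obtain ⟨x, rfl, hx⟩ : ∃ x, v = .inr x ∧ δ₁ ≤ x := by
      simpa [Below] using hv₁
    rw [hfix x hx (below_inr.1 hv)]
    exact hv

/-- Isomorphic colorings have, on a tail, the same diagonal up to a permutation of the colors. -/
theorem diagonal_eq_of_iso [WellFoundedLT Λ] {κ : Cardinal.{u}} (hκ : ℵ₀ ≤ κ)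
    (hΛ : #Λ = Order.succ κ) (hI : ∀ x : Λ, #(Iio x) ≤ κ) (hG : ∀ x y, G x y = G y x)
    (hrec : ∃ x₀, ∀ δ, x₀ ≤ δ → ∀ x, δ ≤ x → ((∀ d, ∃ y < δ, G x y = d) ↔ x = δ))
    (f g : (Bool ⊕ Λ) ≃ (Bool ⊕ Λ)) (π : (Bool ⊕ D) ≃ (Bool ⊕ D))
    (h : ∀ v w, extend G d₀ d₁ t (f v) (g w) = π (extend G d₀ d₁ s v w)) :
    ∃ δ, ∀ x, δ ≤ x → π (.inl (s x)) = .inl (t x) := by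
  obtain ⟨x₀, hrec⟩ := hrec
  obtain ⟨x₁, hx₁⟩ := exists_forall_lt hκ hΛ hI {x₀} (by
    simpa using one_le_aleph0.trans hκ)
  have hx₀₁ : x₀ < x₁ := hx₁ x₀ rfl
  -- The added vertices belong to every `T x`, so closure also controls their images; `x₀ < δ₁`
  -- guarantees that some `x` below `δ₁` exists.
  let T : Λ → Set (Bool ⊕ Λ) := fun x => insert (.inr x) (range Sum.inl)
  have hT : ∀ x, (T x).Finite := fun x => (finite_range _).insert _
  let H : Λ → Set (Bool ⊕ Λ) := fun x =>
    (f '' T x ∪ f.symm '' T x) ∪ (g '' T x ∪ g.symm '' T x)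
  have hH : ∀ x, (H x).Finite := fun x =>
    (((hT x).image _).union ((hT x).image _)).union (((hT x).image _).union ((hT x).image _))
  obtain ⟨δ₁, hδ₁, hclosed⟩ := exists_closed hκ hΛ hI (fun x => Sum.inr ⁻¹' H x) (fun x =>
    (((hH x).preimage Sum.inr_injective.injOn).lt_aleph0.le).trans hκ) x₁
  have hbelow : ∀ v, Below δ₁ v → ∃ x < δ₁, v ∈ T x := by
    rintro (i | x) hv
    · exact ⟨x₀, hx₀₁.trans_le hδ₁, Or.inr ⟨i, rfl⟩⟩
    · exact ⟨x, below_inr.1 hv, Or.inl rfl⟩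
  have hf : ∀ v, Below δ₁ v → Below δ₁ (f v) := by
    intro v hv y hy
    obtain ⟨x, hx, hvx⟩ := hbelow v hv
    exact hclosed x hx y (Or.inl (Or.inl ⟨v, hvx, hy⟩))
  have hf' : ∀ v, Below δ₁ v → Below δ₁ (f.symm v) := by
    intro v hv y hy
    obtain ⟨x, hx, hvx⟩ := hbelow v hv
    exact hclosed x hx y (Or.inl (Or.inr ⟨v, hvx, hy⟩))
  have hg : ∀ v, Below δ₁ v → Below δ₁ (g v) := by
    intro v hv y hy
    obtain ⟨x, hx, hvx⟩ := hbelow v hv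
    exact hclosed x hx y (Or.inr (Or.inl ⟨v, hvx, hy⟩))
  have hg' : ∀ v, Below δ₁ v → Below δ₁ (g.symm v) := by
    intro v hv y hy
    obtain ⟨x, hx, hvx⟩ := hbelow v hv
    exact hclosed x hx y (Or.inr (Or.inr ⟨v, hvx, hy⟩))
  have hfix : ∀ δ, δ₁ ≤ δ → f (.inr δ) = .inr δ ∧ g (.inr δ) = .inr δ := by
    intro δ
    induction δ using WellFoundedLT.induction with
    | ind δ ih =>
      intro hδ
      have hr := hrec δ ((hx₀₁.le.trans hδ₁).trans hδ)
      constructor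
      · refine map_eq_of_below hr f g π h (below_of_fixed hδ _ hf' fun x hx hxδ => ?_)
          (below_of_fixed hδ _ hg fun x hx hxδ => (ih x hxδ hx).2)
        rw [Equiv.symm_apply_eq, (ih x hxδ hx).1]
      · refine map_eq_of_below (d₀ := d₀) (d₁ := d₁) (s := s) (t := t) hr g f π (fun v w => ?_)
          (below_of_fixed hδ _ hg' fun x hx hxδ => ?_)
          (below_of_fixed hδ _ hf fun x hx hxδ => (ih x hxδ hx).1)
        · rw [extend_comm hG, h, extend_comm hG]
        · rw [Equiv.symm_apply_eq, (ih x hxδ hx).2]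
  refine ⟨δ₁, fun x hx => ?_⟩
  have := h (.inr x) (.inr x)
  rw [(hfix x hx).1, (hfix x hx).2, extend_diag, extend_diag] at this
  exact this.symm

end

/-- There are `2 ^ κ⁺` pairwise non-isomorphic colorings `κ⁺ × κ⁺ → κ` without monochromatic
`K_{2,2}` that cannot be extended by a vertex. -/
theorem exists_family (κ : Cardinal.{u}) (hκ : ℵ₀ ≤ κ) (C : Type u) (hC : #C = κ) :
    ∃ (V I : Type u) (F : I → V → V → C), #V = Order.succ κ ∧ #I = 2 ^ Order.succ κ ∧
      (∀ i v w, F i v w = F i w v) ∧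
      (∀ i a₁ a₂ b₁ b₂, a₁ ≠ a₂ → b₁ ≠ b₂ → ¬ ∃ c, F i a₁ b₁ = c ∧ F i a₁ b₂ = c ∧
        F i a₂ b₁ = c ∧ F i a₂ b₂ = c) ∧
      (∀ i (g : V → C), ∃ a b₁ b₂, b₁ ≠ b₂ ∧ g b₁ = g b₂ ∧ F i a b₁ = g b₁ ∧ F i a b₂ = g b₁) ∧
      (∀ i j (f g : V ≃ V) (π : C ≃ C), (∀ v w, F j (f v) (g w) = π (F i v w)) → i = j) := by
  classical
  let Λ : Type u := (Order.succ κ).ord.ToType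
  have hκ' : ℵ₀ ≤ Order.succ κ := hκ.trans (Order.le_succ κ)
  have hΛ : #Λ = Order.succ κ := mk_ord_toType _
  have hI : ∀ x : Λ, #(Iio x) ≤ κ := fun x => Order.lt_succ_iff.1
    ((mk_Iio_lt x (by rw [hΛ, Ordinal.type_toType])).trans_eq hΛ)
  obtain ⟨G, hsymm, hmono, hcommon, hrec⟩ := exists_symmetric_coloring hκ hΛ hI hC
  obtain ⟨e⟩ : Nonempty (Bool ⊕ C ≃ C) := by
    rw [← Cardinal.eq, mk_sum]
    simp only [mk_fintype, Fintype.card_bool, lift_uzero, hC, Nat.cast_ofNat,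
      lift_ofNat]
    exact add_eq_right hκ ((natCast_lt_aleph0 (n := 2)).le.trans hκ)
  obtain ⟨d₀, d₁, hd⟩ : ∃ d₀ d₁ : C, d₀ ≠ d₁ := by
    have : Nontrivial C := one_lt_iff_nontrivial.1 (hC ▸ one_lt_aleph0.trans_le hκ)
    exact exists_pair_ne C
  have : Nonempty (Option Λ) := ⟨none⟩
  obtain ⟨p, hp⟩ := exists_unbounded_fibres hκ hΛ hI (Option Λ) (by
    rw [mk_option, hΛ]
    exact add_le_of_le hκ' le_rfl (one_le_aleph0.trans hκ'))
  -- The fibre of `none` always carries `true`. It shows that the color permutation fixes `true`, so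
  -- an isomorphism cannot exchange the two diagonal colors.
  let s : Set Λ → Λ → Bool := fun X x => decide (∀ y, p x = some y → y ∈ X)
  refine ⟨Bool ⊕ Λ, Set Λ, fun X v w => e (extend G d₀ d₁ (s X) v w), ?_, ?_, ?_, ?_, ?_, ?_⟩
  · simp only [mk_sum, mk_fintype, Fintype.card_bool, lift_uzero, hΛ, Nat.cast_ofNat,
      lift_ofNat]
    exact add_eq_right hκ' ((natCast_lt_aleph0 (n := 2)).le.trans hκ')
  · rw [mk_set, hΛ]
  · intro X v w
    exact congrArg e (extend_comm hsymm v w)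
  · rintro X a₁ a₂ b₁ b₂ ha hb ⟨c, h11, h12, h21, h22⟩
    rw [← Equiv.eq_symm_apply] at h11 h12 h21 h22
    exact extend_no_mono hd hmono a₁ a₂ b₁ b₂ _ ha hb h11 h12 h21 h22
  · intro X g
    obtain ⟨y, z, hg, hyz⟩ : ∃ y z : Λ, g (.inr y) = g (.inr z) ∧ y ≠ z := by
      by_contra! h
      have := mk_le_of_injective (f := fun y : Λ => g (.inr y)) h
      rw [hΛ, hC] at this
      exact absurd this (not_le.2 (Order.lt_succ κ))
    obtain ⟨a, h1, h2⟩ := extend_common (d₀ := d₀) (d₁ := d₁) (s := s X) hcommon y z hyz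
      (e.symm (g (.inr y)))
    exact ⟨a, .inr y, .inr z, fun h => hyz (Sum.inr.inj h), hg, by simp only [h1, e.apply_symm_apply],
      by simp only [h2, e.apply_symm_apply]⟩
  · intro X Y f g π h
    obtain ⟨δ, hδ⟩ := diagonal_eq_of_iso (s := s X) (t := s Y) hκ hΛ hI hsymm hrec f g
      ((e.trans π).trans e.symm) (fun v w => e.injective (by simpa using h v w))
    set ρ := (e.trans π).trans e.symm
    have hnone : ρ (.inl true) = .inl true := by
      obtain ⟨x, hx, hpx⟩ := hp none δ
      have := hδ x hx.le
      simpa [s, hpx] using this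
    ext y
    obtain ⟨x, hx, hpx⟩ := hp (some y) δ
    have hxy := hδ x hx.le
    have hsX : s X x = decide (y ∈ X) := by simp [s, hpx]
    have hsY : s Y x = decide (y ∈ Y) := by simp [s, hpx]
    rw [hsX, hsY] at hxy
    by_cases hX : y ∈ X <;> by_cases hY : y ∈ Y <;> simp only [hX, hY, decide_true, decide_false]
      at hxy ⊢
    · rw [hnone] at hxy
      cases hxy
    · cases ρ.injective (hxy.trans hnone.symm)

end BipartiteColoring

/-! ### From colorings to maximal models -/

namespace HatStructure

open FirstOrder FirstOrder.Language

variable {L : FirstOrder.Language.{v, w}}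

/-- The colors as a subset of the universe of `ofColoring`. -/
noncomputable def colorEquiv (V C : Type u) : C ≃ Set.range (fun c : C => (.inr (.inr c) : V ⊕ V ⊕ C)) :=
  Equiv.ofInjective _ (Sum.inr_injective.comp Sum.inr_injective)

/-- The structure given by a coloring `F` of the complete bipartite graph on two copies of `V`. -/
noncomputable def ofColoring {V C : Type u} [L.Structure C] (F : V → V → C) : HatStructure.{u} L where
  carrier := V ⊕ V ⊕ C
  A := Set.range Sum.inl
  B := Set.range fun v => .inr (.inl v)
  C := Set.range fun c => .inr (.inr c)
  E x y z := ∃ a b, x = .inl a ∧ y = .inr (.inl b) ∧ z = .inr (.inr (F a b))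
  colorStructure := (colorEquiv V C).inducedStructure

section

variable {V C : Type u} [L.Structure C] {F : V → V → C}

/-- The colors of `ofColoring F` form a copy of `C`. -/
noncomputable def ofColoringEquiv (F : V → V → C) : C ≃[L] (ofColoring (L := L) F).C :=
  (colorEquiv V C).inducedStructureEquiv

theorem ofColoringEquiv_apply (c : C) :
    (ofColoringEquiv (L := L) F c).val = .inr (.inr c) := rfl

theorem ofColoring_E {a b : V} {c : C} :
    (ofColoring (L := L) F).E (.inl a) (.inr (.inl b)) (.inr (.inr c)) ↔ F a b = c := by
  constructor
  · rintro ⟨a', b', ha, hb, hc⟩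
    obtain rfl := Sum.inl.inj ha
    obtain rfl := Sum.inl.inj (Sum.inr.inj hb)
    exact (Sum.inr.inj (Sum.inr.inj hc)).symm
  · rintro rfl
    exact ⟨a, b, rfl, rfl, rfl⟩

theorem ofColoring_sigma1 [Nonempty V] [Nonempty C]
    (hF : ∀ a₁ a₂ b₁ b₂, a₁ ≠ a₂ → b₁ ≠ b₂ → ¬ ∃ c, F a₁ b₁ = c ∧ F a₁ b₂ = c ∧
        F a₂ b₁ = c ∧ F a₂ b₂ = c) : (ofColoring (L := L) F).Sigma1 where
  nonempty_A := Set.range_nonempty _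
  nonempty_B := Set.range_nonempty _
  nonempty_C := Set.range_nonempty _
  cover := by
    refine Set.eq_univ_of_forall ?_
    rintro (a | b | c)
    · exact Or.inl (Or.inl ⟨a, rfl⟩)
    · exact Or.inl (Or.inr ⟨b, rfl⟩)
    · exact Or.inr ⟨c, rfl⟩
  disjoint_AB := by
    rw [Set.disjoint_left]
    rintro _ ⟨a, rfl⟩ ⟨b, hb⟩
    cases hb
  disjoint_AC := by
    rw [Set.disjoint_left]
    rintro _ ⟨a, rfl⟩ ⟨b, hb⟩
    cases hb
  disjoint_BC := by
    rw [Set.disjoint_left]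
    rintro _ ⟨a, rfl⟩ ⟨b, hb⟩
    cases hb
  sort_E := by
    rintro _ _ _ ⟨a, b, rfl, rfl, rfl⟩
    exact ⟨⟨a, rfl⟩, ⟨b, rfl⟩, ⟨_, rfl⟩⟩
  function_E := by
    rintro _ ⟨a, rfl⟩ _ ⟨b, rfl⟩
    refine ⟨.inr (.inr (F a b)), ⟨a, b, rfl, rfl, rfl⟩, ?_⟩
    rintro _ ⟨a', b', ha, hb, rfl⟩
    obtain rfl := Sum.inl.inj ha
    obtain rfl := Sum.inl.inj (Sum.inr.inj hb)
    rfl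
  no_mono := by
    rintro _ ⟨a₁, rfl⟩ _ ⟨a₂, rfl⟩ _ ⟨b₁, rfl⟩ _ ⟨b₂, rfl⟩ ha hb ⟨c, h11, h12, h21, h22⟩
    obtain ⟨_, _, -, -, rfl⟩ := id h11
    exact hF a₁ a₂ b₁ b₂ (fun h => ha (congrArg _ h)) (fun h => hb (h ▸ rfl))
      ⟨_, ofColoring_E.1 h11, ofColoring_E.1 h12, ofColoring_E.1 h21, ofColoring_E.1 h22⟩

theorem ofColoring_hasType (F : V → V → C) :
    (ofColoring (L := L) F).HasType (Cardinal.mk V) (Cardinal.mk V) :=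
  ⟨Cardinal.mk_range_eq _ Sum.inl_injective,
    Cardinal.mk_range_eq _ (Sum.inr_injective.comp Sum.inl_injective)⟩

/-- An isomorphism of colorings permutes the two sides and the colors. -/
theorem exists_equiv_of_isomorphic {F F' : V → V → C}
    (h : (ofColoring (L := L) F).Isomorphic (ofColoring (L := L) F')) :
    ∃ (f g : V ≃ V) (π : C ≃ C), ∀ v w, F' (f v) (g w) = π (F v w) := by
  obtain ⟨φ, hφ⟩ := h
  have hA : ∀ v, ∃ v', φ.toFun (.inl v) = .inl v' := fun v => by
    obtain ⟨v', h⟩ := (φ.mem_A (.inl v)).2 ⟨v, rfl⟩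
    exact ⟨v', h.symm⟩
  have hB : ∀ v, ∃ v', φ.toFun (.inr (.inl v)) = .inr (.inl v') := fun v => by
    obtain ⟨v', h⟩ := (φ.mem_B (.inr (.inl v))).2 ⟨v, rfl⟩
    exact ⟨v', h.symm⟩
  have hC : ∀ c, ∃ c', φ.toFun (.inr (.inr c)) = .inr (.inr c') := fun c => by
    obtain ⟨c', h⟩ := (φ.mem_C (.inr (.inr c))).2 ⟨c, rfl⟩
    exact ⟨c', h.symm⟩
  choose f hf using hA
  choose g hg using hB
  choose π hπ using hC
  have hfb : Function.Bijective f := by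
    constructor
    · intro v w hvw
      exact Sum.inl.inj (φ.injective (by rw [hf, hf, hvw]))
    · intro v
      obtain ⟨x, hx⟩ := hφ (.inl v)
      obtain ⟨w, rfl⟩ := (φ.mem_A x).1 (hx ▸ ⟨v, rfl⟩)
      exact ⟨w, Sum.inl.inj ((hf w).symm.trans hx)⟩
  have hgb : Function.Bijective g := by
    constructor
    · intro v w hvw
      exact Sum.inl.inj (Sum.inr.inj (φ.injective (by rw [hg, hg, hvw])))
    · intro v
      obtain ⟨x, hx⟩ := hφ (.inr (.inl v))
      obtain ⟨w, rfl⟩ := (φ.mem_B x).1 (hx ▸ ⟨v, rfl⟩)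
      exact ⟨w, Sum.inl.inj (Sum.inr.inj ((hg w).symm.trans hx))⟩
  have hπb : Function.Bijective π := by
    constructor
    · intro v w hvw
      exact Sum.inr.inj (Sum.inr.inj (φ.injective (by rw [hπ, hπ, hvw])))
    · intro v
      obtain ⟨x, hx⟩ := hφ (.inr (.inr v))
      obtain ⟨w, rfl⟩ := (φ.mem_C x).1 (hx ▸ ⟨v, rfl⟩)
      exact ⟨w, Sum.inr.inj (Sum.inr.inj ((hπ w).symm.trans hx))⟩
  refine ⟨.ofBijective f hfb, .ofBijective g hgb, .ofBijective π hπb, fun v w => ?_⟩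
  have h := (φ.map_E (.inl v) (.inr (.inl w)) (.inr (.inr (F v w)))).2 (ofColoring_E.2 rfl)
  rw [hf, hg, hπ] at h
  exact ofColoring_E.1 h

end

end HatStructure

namespace AbstractElementaryClass

open FirstOrder FirstOrder.Language HatStructure

variable {L : FirstOrder.Language.{v, w}} {K : AbstractElementaryClass.{u} L}

/-- A coloring by a maximal model of `K` to which no vertex can be added gives a maximal model. -/
theorem hatMaximal_ofColoring {V C : Type u} [L.Structure C] [Nonempty V] [Nonempty C]
    (hC : K.Mem C)
    (hmax : ∀ (N : Type u) [L.Structure N] (f : C ↪[L] N), K.StrongEmb f → Function.Surjective f)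
    {F : V → V → C} (hsymm : ∀ v w, F v w = F w v)
    (hF : ∀ a₁ a₂ b₁ b₂, a₁ ≠ a₂ → b₁ ≠ b₂ → ¬ ∃ c, F a₁ b₁ = c ∧ F a₁ b₂ = c ∧
        F a₂ b₁ = c ∧ F a₂ b₂ = c)
    (hext : ∀ g : V → C, ∃ a b₁ b₂, b₁ ≠ b₂ ∧ g b₁ = g b₂ ∧ F a b₁ = g b₁ ∧ F a b₂ = g b₁) :
    K.HatMaximal (ofColoring (L := L) F) := by
  have hmem : K.Mem (ofColoring (L := L) F).C := K.mem_iso (ofColoringEquiv F) hC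
  refine ⟨⟨ofColoring_sigma1 hF, hmem⟩, fun N f hf => ?_⟩
  obtain ⟨-, ⟨hN, -⟩, hstrong⟩ := hf
  have hcolor : ∀ c ∈ N.C, ∃ x : C, f.toFun (.inr (.inr x)) = c := by
    -- Maximality of `C` makes this strong embedding onto: `N` has no new colors.
    have hcomp : K.StrongEmb (f.color.comp (ofColoringEquiv F).toEmbedding) :=
      StrongEmb.comp hstrong (StrongEmb.of_surjective hmem (ofColoringEquiv F).surjective)
    intro c hc
    obtain ⟨x, hx⟩ := hmax _ _ hcomp ⟨c, hc⟩
    refine ⟨x, ?_⟩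
    have h := f.color_eq (ofColoringEquiv F x)
    rw [ofColoringEquiv_apply] at h
    rw [← h]
    exact congrArg Subtype.val hx
  have hE : ∀ a b c, F a b = c →
      N.E (f.toFun (.inl a)) (f.toFun (.inr (.inl b))) (f.toFun (.inr (.inr c))) :=
    fun a b c h => (f.map_E _ _ _).2 (ofColoring_E.2 h)
  have hA : ∀ a, f.toFun (.inl a) ∈ N.A := fun a => (f.mem_A _).2 ⟨a, rfl⟩
  have hB : ∀ b, f.toFun (.inr (.inl b)) ∈ N.B := fun b => (f.mem_B _).2 ⟨b, rfl⟩
  have hAne : ∀ a a', a ≠ a' → f.toFun (.inl a) ≠ f.toFun (.inl a') :=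
    fun a a' h h' => h (Sum.inl.inj (f.injective h'))
  have hBne : ∀ b b', b ≠ b' → f.toFun (.inr (.inl b)) ≠ f.toFun (.inr (.inl b')) :=
    fun b b' h h' => h (Sum.inl.inj (Sum.inr.inj (f.injective h')))
  have hval : ∀ a ∈ N.A, ∀ b ∈ N.B, ∃ c : C, N.E a b (f.toFun (.inr (.inr c))) := by
    intro a ha b hb
    obtain ⟨c, hc, -⟩ := hN.function_E a ha b hb
    obtain ⟨x, rfl⟩ := hcolor c (hN.sort_E _ _ _ hc).2.2
    exact ⟨x, hc⟩
  intro x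
  have hx : x ∈ N.A ∪ N.B ∪ N.C := hN.cover ▸ Set.mem_univ x
  rcases hx with (hx | hx) | hx
  · by_contra hne
    -- The row `g` of a new vertex closes a monochromatic K₂,₂ with the vertices from `hext`;
    -- symmetry of `F` handles the other side.
    choose g hg using fun v => hval x hx _ (hB v)
    obtain ⟨a, b₁, b₂, hb, hgb, h1, h2⟩ := hext g
    exact hN.no_mono x hx _ (hA a) _ (hB b₁) _ (hB b₂) (fun h => hne ⟨_, h.symm⟩) (hBne _ _ hb)
      ⟨_, hg b₁, hgb ▸ hg b₂, hE _ _ _ h1, hE _ _ _ h2⟩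
  · by_contra hne
    choose g hg using fun v => hval _ (hA v) x hx
    obtain ⟨a, b₁, b₂, hb, hgb, h1, h2⟩ := hext g
    rw [hsymm] at h1 h2
    exact hN.no_mono _ (hA b₁) _ (hA b₂) x hx _ (hB a) (hAne _ _ hb) (fun h => hne ⟨_, h.symm⟩)
      ⟨_, hg b₁, hE _ _ _ h1, hgb ▸ hg b₂, hE _ _ _ h2⟩
  · obtain ⟨c, hc⟩ := hcolor x hx
    exact ⟨_, hc⟩

end AbstractElementaryClass

theorem mainTheorem4 {L : FirstOrder.Language.{v, w}} (K : AbstractElementaryClass.{u} L)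
    (κ : Cardinal.{u}) (hκ : Cardinal.aleph0 ≤ κ)
    (hmodel : ∃ (M : Type u) (_ : L.Structure M), K.Mem M ∧ Cardinal.mk M = κ)
    (hbound : ∀ (M : Type u) [L.Structure M], K.Mem M → Cardinal.mk M ≤ κ) :
    ∃ (I : Type u) (M : I → HatStructure.{u} L),
      Cardinal.mk I = 2 ^ Order.succ κ ∧
      (∀ i, K.HatMaximal (M i) ∧ (M i).HasType (Order.succ κ) (Order.succ κ)) ∧
      ∀ i j, i ≠ j → ¬ (M i).Isomorphic (M j) := by
  obtain ⟨C, _, hC, hcard, hmax⟩ := K.exists_maximal_model κ hκ hmodel hbound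
  obtain ⟨V, I, F, hV, hI, hsymm, hF, hext, hiso⟩ :=
    BipartiteColoring.exists_family κ hκ C hcard
  have : Nonempty C := Cardinal.mk_ne_zero_iff.1 (by
    rw [hcard]
    exact (Cardinal.aleph0_pos.trans_le hκ).ne')
  have : Nonempty V := Cardinal.mk_ne_zero_iff.1 (by
    rw [hV]
    exact (Cardinal.aleph0_pos.trans_le (hκ.trans (Order.le_succ κ))).ne')
  refine ⟨I, fun i => HatStructure.ofColoring (F i), hI, fun i => ⟨?_, ?_⟩, fun i j hij h => ?_⟩
  · exact AbstractElementaryClass.hatMaximal_ofColoring hC hmax (hsymm i) (hF i) (hext i)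
  · rw [← hV]
    exact HatStructure.ofColoring_hasType (F i)
  · obtain ⟨f, g, π, hfg⟩ := HatStructure.exists_equiv_of_isomorphic h
    exact hij (hiso i j f g π hfg)
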